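/- Let $\lambda$ be the standard (Haar, coin-tossing) probability measure on $2^\omega$ and $\lambda^*$ its outer measure. An ideal on a countable set $X$ is a nonempty family of subsets of $X$ closed under subsets and finite unions; $\mathcal I^+=\mathcal P(X)\setminus\mathcal I$ denotes the family of $\mathcal I$-positive sets. Given an ideal $\mathcal I$ on $X$ and ideals $\mathcal J_i$ on sets $Y_i$ ($i\in X$), $\lim_{i\to\mathcal I}\mathcal J_i$ is the ideal on $\bigcup_{i\in X}(\{i\}\times Y_i)$ of all sets $A$ with $\{i\in X:\{y\in Y_i:(i,y)\in A\}\notin\mathcal J_i\}\in\mathcal I$; if $\mathcal J_i=\mathcal J$ for all $i$, it is denoted by $\mathcal I\times\mathcal J$. Let $fin$ be the ideal of finite subsets of $\omega$ and, for a limit ordinal $\alpha$, let $bnd(\alpha)$ be the ideal of bounded subsets of $\alpha$. For $\alpha<\omega_1$ define a countable set $X_\alpha$ and an ideal $fin^\alpha$ on $X_\alpha$ recursively: $X_0=\{0\}$ and $fin^0=\{\emptyset\}$; $X_1=\omega$ and $fin^1=fin$; $X_{\alpha+1}=\omega\times X_\alpha$ and $fin^{\alpha+1}=fin\times fin^\alpha$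 for $\alpha\ge 1$; and $X_\alpha=\bigcup_{\beta<\alpha}(\{\beta\}\times X_\beta)$ and $fin^\alpha=\lim_{\beta\to bnd(\alpha)}fin^\beta$ for limit $\alpha$. An ideal $\mathcal I$ on a countable set $X$ (with the discrete topology) has the *Fubini property* if for every Borel set $A\subseteq X\times 2^\omega$ and every $\varepsilon>0$, $\{n\in X:\lambda^*(A_n)>\varepsilon\}\in\mathcal I^+$ implies $\lambda^*(\{x\in 2^\omega: A^x\in\mathcal I^+\})\ge\varepsilon$, where $A_n=\{x:(n,x)\in A\}$ and $A^x=\{n:(n,x)\in A\}$. The *Solecki ideal* $\mathcal S$ is the ideal on $\Omega=\{U\subseteq 2^\omega: U\text{ clopen},\ \lambda(U)=1/2\}$ generated by the sets $I_x=\{U\in\Omega:x\in U\}$, $x\in 2^\omega$. For ideals $\mathcal I$ on $X$ and $\mathcal J$ on $Y$, $\mathcal I\le_K\mathcal J$ (Katětov order) means that there is $f:Y\to X$ with $f^{-1}[I]\in\mathcal J$ for all $I\in\mathcal I$. **Theorem.** For every $\alpha<\omega_1$, the ideal $fin^\alpha$ has the Fubini property. In particular, $\mathcal S\nleq_K fin^\alpha$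 for every $\alpha<\omega_1$. -/

import Mathlib

open MeasureTheory
open scoped Ordinal

noncomputable section

namespace FubiniIdeals

/-! An ideal on a set `X` is a (nonempty) family of subsets of `X` closed under subsets and finite
unions, i.e. an `Order.Ideal (Set X)`. -/

/-- Build an ideal on `X` from its usual closure properties. -/
def mkIdeal {X : Type*} (𝓘 : Set (Set X)) (h_empty : ∅ ∈ 𝓘)
    (h_subset : ∀ A B : Set X, A ⊆ B → B ∈ 𝓘 → A ∈ 𝓘)
    (h_union : ∀ A B : Set X, A ∈ 𝓘 → B ∈ 𝓘 → A ∪ B ∈ 𝓘) : Order.Ideal (Set X) where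
  carrier := 𝓘
  lower' := fun B A hAB hB => h_subset A B hAB hB
  nonempty' := ⟨∅, h_empty⟩
  directed' := fun A hA B hB =>
    ⟨A ∪ B, h_union A B hA hB, Set.subset_union_left, Set.subset_union_right⟩

/-- The family of `I`-positive sets. -/
def positive {X : Type*} (I : Order.Ideal (Set X)) : Set (Set X) := {A | A ∉ I}

/-- The Katětov order: `I` is Katětov below `J`. -/
def KatetovLE {X Y : Type*} (I : Order.Ideal (Set X)) (J : Order.Ideal (Set Y)) : Prop :=
  ∃ f : Y → X, ∀ A ∈ I, f ⁻¹' A ∈ J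

/-- The ideal of finite subsets of `X`. -/
def finIdeal (X : Type*) : Order.Ideal (Set X) :=
  mkIdeal {A | A.Finite} Set.finite_empty (fun _ _ h hB => hB.subset h)
    (fun _ _ hA hB => hA.union hB)

/-- `bnd(α)`: the ideal on `α = {β | β < α}` of all subsets bounded in `α`. -/
def bnd (α : Ordinal.{0}) (hα : Order.IsSuccLimit α) : Order.Ideal (Set (Set.Iio α)) :=
  mkIdeal {A | ∃ γ : Set.Iio α, ∀ β ∈ A, β < γ}
    ⟨⟨0, hα.bot_lt⟩, fun _ h => h.elim⟩
    (fun _ _ h ⟨γ, hγ⟩ => ⟨γ, fun β hβ => hγ β (h hβ)⟩)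
    (fun _ _ ⟨γ, hγ⟩ ⟨δ, hδ⟩ => ⟨max γ δ, fun β hβ =>
      hβ.elim (fun h => lt_max_of_lt_left (hγ β h)) (fun h => lt_max_of_lt_right (hδ β h))⟩)

/-- `lim_{i → I} J i`, an ideal on `⋃ i, {i} × Y i`: a set `A` belongs to it iff for
`I*`-almost all `i` the section `A(i)` is in `J i`. -/
def idealLim {X : Type*} {Y : X → Type*} (I : Order.Ideal (Set X))
    (J : ∀ i, Order.Ideal (Set (Y i))) : Order.Ideal (Set (Σ i, Y i)) :=
  mkIdeal {A | {i | {y | (⟨i, y⟩ : Σ i, Y i) ∈ A} ∈ J i}ᶜ ∈ I}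
    (I.lower (a := ∅) (fun i hi => hi ((J i).lower (Set.empty_subset _) (J i).nonempty.some_mem))
      (I.lower (Set.empty_subset _) I.nonempty.some_mem))
    (fun _ _ h hB => I.lower (fun i hi hi' => hi ((J i).lower (fun _ hy => h hy) hi')) hB)
    (fun _ _ hA hB => I.lower
      (fun i hi => by
        by_contra hcon
        simp only [Set.sup_eq_union, Set.mem_union, Set.mem_compl_iff, not_or, not_not] at hcon
        exact hi ((J i).sup_mem hcon.1 hcon.2))
      (I.sup_mem hA hB))

/-- The Fubini product `I × J`, an ideal on `X × Y`. -/
def fubiniProd {X Y : Type*} (I : Order.Ideal (Set X)) (J : Order.Ideal (Set Y)) :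
    Order.Ideal (Set (X × Y)) :=
  mkIdeal {A | {x | {y | (x, y) ∈ A} ∈ J}ᶜ ∈ I}
    (I.lower (a := ∅) (fun _ hi => hi (J.lower (Set.empty_subset _) J.nonempty.some_mem))
      (I.lower (Set.empty_subset _) I.nonempty.some_mem))
    (fun _ _ h hB => I.lower (fun _ hi hi' => hi (J.lower (fun _ hy => h hy) hi')) hB)
    (fun _ _ hA hB => I.lower
      (fun i hi => by
        by_contra hcon
        simp only [Set.sup_eq_union, Set.mem_union, Set.mem_compl_iff, not_or, not_not] at hcon
        exact hi (J.sup_mem hcon.1 hcon.2))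
      (I.sup_mem hA hB))

open Classical in
/-- The pair `(X_α, fin^α)`, by recursion on `α`:
`X_0 = {0}`, `fin^0 = {∅}`; `X_1 = ω`, `fin^1 = fin`;
`X_{α+1} = ω × X_α`, `fin^{α+1} = fin × fin^α` for `α ≥ 1`;
`X_α = ⋃_{β<α} {β} × X_β`, `fin^α = lim_{β → bnd(α)} fin^β` for `α` a limit.
(The underlying sets live in `Type 1`, as do the sets of ordinals `{β | β < α}`.) -/
def finPowPair (α : Ordinal.{0}) : Σ X : Type 1, Order.Ideal (Set X) :=
  Ordinal.limitRecOn (motive := fun _ => Σ X : Type 1, Order.Ideal (Set X)) α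
    ⟨PUnit, Order.Ideal.principal ∅⟩
    (fun β P =>
      if β = 0 then ⟨ULift ℕ, finIdeal (ULift ℕ)⟩
      else ⟨ℕ × P.1, fubiniProd (finIdeal ℕ) P.2⟩)
    (fun β hβ P =>
      ⟨Σ γ : Set.Iio β, (P γ.1 γ.2).1, idealLim (bnd β hβ) (fun γ => (P γ.1 γ.2).2)⟩)

/-- The set `X_α`. -/
def FinPowSpace (α : Ordinal.{0}) : Type 1 := (finPowPair α).1

/-- The ideal `fin^α` on `X_α`. -/
def finPow (α : Ordinal.{0}) : Order.Ideal (Set (FinPowSpace α)) := (finPowPair α).2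

/-- The standard (Haar, coin-tossing) probability measure on the Cantor space `2^ω`. -/
def cantorMeasure : Measure (ℕ → Bool) :=
  Measure.infinitePi (fun _ : ℕ => (PMF.uniformOfFintype Bool).toMeasure)

/-- The Fubini property of an ideal `I` on a countable (discrete) set `X`: for every Borel set
`A ⊆ X × 2^ω` and every `ε > 0`, if the set of all `n` with `λ*(A_n) > ε` is `I`-positive, then
`λ*({x | A^x is I-positive}) ≥ ε`. A Mathlib measure applied to an arbitrary set is its outer
measure. -/
def FubiniProperty {X : Type*} (I : Order.Ideal (Set X)) : Prop :=
  letI : TopologicalSpace X := ⊥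
  ∀ A : Set (X × (ℕ → Bool)), MeasurableSet[borel (X × (ℕ → Bool))] A →
    ∀ ε : ℝ, 0 < ε →
      {n : X | ENNReal.ofReal ε < cantorMeasure {x | (n, x) ∈ A}} ∈ positive I →
      ENNReal.ofReal ε ≤ cantorMeasure {x : ℕ → Bool | {n : X | (n, x) ∈ A} ∈ positive I}

/-- `Ω`: the clopen subsets of `2^ω` of measure `1/2`. -/
def SoleckiSpace : Type :=
  {U : TopologicalSpace.Clopens (ℕ → Bool) // cantorMeasure (U : Set (ℕ → Bool)) = 1 / 2}

/-- The generator `I_x = {U ∈ Ω | x ∈ U}`. -/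
def soleckiSet (x : ℕ → Bool) : Set SoleckiSpace := {U | x ∈ U.1}

/-- The Solecki ideal: the ideal on `Ω` generated by the sets `I_x`, `x ∈ 2^ω`. -/
def solecki : Order.Ideal (Set SoleckiSpace) :=
  mkIdeal {B | ∃ F : Set (ℕ → Bool), F.Finite ∧ B ⊆ ⋃ x ∈ F, soleckiSet x}
    ⟨∅, Set.finite_empty, Set.empty_subset _⟩
    (fun _ _ h ⟨F, hF, hB⟩ => ⟨F, hF, h.trans hB⟩)
    (fun _ _ ⟨F, hF, hA⟩ ⟨G, hG, hB⟩ => ⟨F ∪ G, hF.union hG, by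
      rw [Set.biUnion_union]
      exact Set.union_subset_union hA hB⟩)

end FubiniIdeals

end

/-! Call an ideal `I` on `X` measurably Fubini for a finite measure `μ` on `Ω` when, for every family
`A : X → Set Ω` of measurable sets, the set `{x | {n | x ∈ A n} ∉ I}` of points lying in
`I`-positively many `A n` is measurable, and has measure at least `ε` as soon as `I`-positively many
`A n` have. Demanding measurability makes the property stable under Fubini products and limits: the
inner ideals turn a doubly indexed family into a singly indexed family of measurable sets, to which
the property of the outer ideal applies.

The outer ideals in the construction of `fin^α`, `α < ω₁`, are `fin` on a countable set and `bnd β`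
for countable limits `β`. Both have a countable cofinal subset `𝓒`, and for such an ideal the points
in positively many `B n` form the set `⋂ C ∈ 𝓒, ⋃ n ∉ C, B n`, a countable downward directed
intersection of measurable sets, each of measure at least `ε`. Continuity from above therefore gives
the property (`IsMeasurablyFubini.of_hasCountableCofinal`), and transfinite induction gives it for
all `fin^α`. Borel subsets of `X × 2^ω` have measurable sections, so the Fubini property follows.

If `f` witnessed `𝓢 ≤_K I` for a proper ideal `I` with the Fubini property, then applying the property
to the open set `{(n, x) | x ∈ f n}`, all of whose sections have measure `1/2`, yields a point `x`
with `f ⁻¹' I_x` positive, a contradiction. Properness of `fin^α` is again an induction. -/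

open MeasureTheory
open scoped Ordinal ENNReal

namespace FubiniIdeals

/-! ### Ideals with a countable cofinal subset -/

/-- The ideal `I` has a countable cofinal subset: countably many members of `I` such that every
member of `I` is contained in one of them. -/
def HasCountableCofinal {X : Type*} (I : Order.Ideal (Set X)) : Prop :=
  ∃ 𝓒 : Set (Set X), 𝓒.Countable ∧ (∀ C ∈ 𝓒, C ∈ I) ∧ ∀ S ∈ I, ∃ C ∈ 𝓒, S ⊆ C

theorem hasCountableCofinal_finIdeal (X : Type*) [Countable X] :
    HasCountableCofinal (finIdeal X) := by
  refine ⟨Set.range fun s : Finset X => (s : Set X), Set.countable_range _, ?_, ?_⟩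
  · rintro _ ⟨s, rfl⟩
    exact s.finite_toSet
  · intro S hS
    have hS : S.Finite := hS
    exact ⟨_, ⟨hS.toFinset, rfl⟩, by simp⟩

theorem hasCountableCofinal_bnd (α : Ordinal.{0}) (hα : Order.IsSuccLimit α)
    [Countable (Set.Iio α)] : HasCountableCofinal (bnd α hα) := by
  refine ⟨Set.range fun γ : Set.Iio α => Set.Iio γ, Set.countable_range _, ?_, ?_⟩
  · rintro _ ⟨γ, rfl⟩
    exact ⟨γ, fun _ h => h⟩
  · rintro S ⟨γ, hγ⟩
    exact ⟨_, ⟨γ, rfl⟩, hγ⟩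

theorem countable_Iio_of_lt_omega_one {α : Ordinal.{0}} (hα : α < ω₁) :
    Countable (Set.Iio α) := by
  rw [← Cardinal.mk_le_aleph0_iff, Cardinal.mk_Iio_ordinal, Cardinal.lift_le_aleph0]
  have h := Cardinal.lt_omega_iff_card_lt.1 hα
  rwa [← Cardinal.succ_aleph0, Order.lt_succ_iff] at h

/-! ### The measurable Fubini property -/

/-- A strengthening of the Fubini property that can be iterated: measurable families of sets indexed
by `X` have a measurable set of points lying in `I`-positively many members, and this set has measure
at least `ε` if `I`-positively many members have. -/
structure IsMeasurablyFubini {X Ω : Type*} [MeasurableSpace Ω] (μ : Measure Ω)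
    (I : Order.Ideal (Set X)) : Prop where
  measurableSet_positive : ∀ A : X → Set Ω, (∀ n, MeasurableSet (A n)) →
    MeasurableSet {x | {n | x ∈ A n} ∉ I}
  le_measure_positive : ∀ A : X → Set Ω, (∀ n, MeasurableSet (A n)) → ∀ ε : ℝ≥0∞,
    {n | ε ≤ μ (A n)} ∉ I → ε ≤ μ {x | {n | x ∈ A n} ∉ I}

namespace IsMeasurablyFubini

variable {X Ω : Type*} [MeasurableSpace Ω] {μ : Measure Ω}

theorem of_hasCountableCofinal [Countable X] [IsFiniteMeasure μ] {I : Order.Ideal (Set X)}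
    (hI : HasCountableCofinal I) : IsMeasurablyFubini μ I := by
  obtain ⟨𝓒, h𝓒, hmem, hcof⟩ := hI
  have := h𝓒.to_subtype
  have hpos (S : Set X) : S ∉ I ↔ ∀ C : 𝓒, ∃ n, n ∉ C.1 ∧ n ∈ S := by
    constructor
    · intro hS C
      by_contra! h
      exact hS (I.lower (fun n hn => by_contra fun hn' => h n hn' hn) (hmem C C.2))
    · intro h hS
      obtain ⟨C, hC, hSC⟩ := hcof S hS
      obtain ⟨n, hn, hnS⟩ := h ⟨C, hC⟩
      exact hn (hSC hnS)
  have hset (A : X → Set Ω) :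
      {x | {n | x ∈ A n} ∉ I} = ⋂ C : 𝓒, ⋃ n, ⋃ (_ : n ∉ C.1), A n := by
    ext x
    simp [hpos]
  have hmeas (A : X → Set Ω) (hA : ∀ n, MeasurableSet (A n)) (C : 𝓒) :
      MeasurableSet (⋃ n, ⋃ (_ : n ∉ C.1), A n) :=
    .iUnion fun n => .iUnion fun _ => hA n
  refine ⟨fun A hA => ?_, fun A hA ε hε => ?_⟩
  · rw [hset]
    exact .iInter fun C => hmeas A hA C
  · -- The ideal contains `∅`, so `𝓒` is nonempty and the intersection is not an empty one.
    obtain ⟨C₀, hC₀, -⟩ := hcof ∅ (I.lower (Set.empty_subset _) I.nonempty.some_mem)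
    have : Nonempty 𝓒 := ⟨⟨C₀, hC₀⟩⟩
    rw [hset, Directed.measure_iInter (fun C => (hmeas A hA C).nullMeasurableSet) ?_
      ⟨⟨C₀, hC₀⟩, measure_ne_top _ _⟩]
    · refine le_iInf fun C => ?_
      obtain ⟨n, hn, hεn⟩ := (hpos _).1 hε C
      exact hεn.trans (measure_mono (Set.subset_iUnion₂ (s := fun n (_ : n ∉ C.1) => A n) n hn))
    · intro C D
      obtain ⟨E, hE, hCDE⟩ := hcof _ (I.sup_mem (hmem C C.2) (hmem D D.2))
      refine ⟨⟨E, hE⟩, ?_, ?_⟩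
      · exact Set.iUnion_mono fun n => Set.iUnion_mono' fun hn =>
          ⟨fun h => hn (hCDE (Or.inl h)), subset_rfl⟩
      · exact Set.iUnion_mono fun n => Set.iUnion_mono' fun hn =>
          ⟨fun h => hn (hCDE (Or.inr h)), subset_rfl⟩

theorem idealLim {Y : X → Type*} {I : Order.Ideal (Set X)} {J : ∀ i, Order.Ideal (Set (Y i))}
    (hI : IsMeasurablyFubini μ I) (hJ : ∀ i, IsMeasurablyFubini μ (J i)) :
    IsMeasurablyFubini μ (idealLim I J) := by
  have hB (A : (Σ i, Y i) → Set Ω) (hA : ∀ n, MeasurableSet (A n)) (i : X) :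
      MeasurableSet {x | {y | x ∈ A ⟨i, y⟩} ∉ J i} :=
    (hJ i).measurableSet_positive _ fun y => hA ⟨i, y⟩
  refine ⟨fun A hA => hI.measurableSet_positive _ (hB A hA), fun A hA ε hε => ?_⟩
  refine hI.le_measure_positive _ (hB A hA) ε fun h => hε (I.lower (fun i hi => ?_) h)
  exact (hJ i).le_measure_positive _ (fun y => hA ⟨i, y⟩) ε hi

theorem fubiniProd {Y : Type*} {I : Order.Ideal (Set X)} {J : Order.Ideal (Set Y)}
    (hI : IsMeasurablyFubini μ I) (hJ : IsMeasurablyFubini μ J) :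
    IsMeasurablyFubini μ (fubiniProd I J) := by
  have hB (A : X × Y → Set Ω) (hA : ∀ n, MeasurableSet (A n)) (i : X) :
      MeasurableSet {x | {y | x ∈ A (i, y)} ∉ J} :=
    hJ.measurableSet_positive _ fun y => hA (i, y)
  refine ⟨fun A hA => hI.measurableSet_positive _ (hB A hA), fun A hA ε hε => ?_⟩
  refine hI.le_measure_positive _ (hB A hA) ε fun h => hε (I.lower (fun i hi => ?_) h)
  exact hJ.le_measure_positive _ (fun y => hA (i, y)) ε hi

end IsMeasurablyFubini

theorem FubiniProperty.of_isMeasurablyFubini {X : Type*} {I : Order.Ideal (Set X)}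
    (hI : IsMeasurablyFubini cantorMeasure I) : FubiniProperty I := by
  let _ : TopologicalSpace X := ⊥
  intro A hA ε _ hpos
  have hsec (n : X) : MeasurableSet {x : ℕ → Bool | (n, x) ∈ A} := by
    have hc : Continuous fun x : ℕ → Bool => (n, x) := by fun_prop
    rw [BorelSpace.measurable_eq (α := ℕ → Bool)]
    exact hc.borel_measurable hA
  exact hI.le_measure_positive _ hsec _ fun h =>
    hpos (I.lower (Set.ofPred_subset_ofPred.2 fun n hn => hn.le) h)

/-! ### The ideals `fin^α` -/

/-- Transfinite induction for the ideals `fin^α`, `α < ω₁`, along their recursive construction. -/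
theorem finPow_induction {p : ∀ {X : Type 1}, Order.Ideal (Set X) → Prop}
    (zero : p (Order.Ideal.principal (∅ : Set PUnit)))
    (one : p (finIdeal (ULift ℕ)))
    (succ : ∀ {X : Type 1} (I : Order.Ideal (Set X)), p I → p (fubiniProd (finIdeal ℕ) I))
    (limit : ∀ (β : Ordinal.{0}) (hβ : Order.IsSuccLimit β), β < ω₁ →
      ∀ {Y : Set.Iio β → Type 1} (J : ∀ γ, Order.Ideal (Set (Y γ))), (∀ γ, p (J γ)) →
        p (idealLim (bnd β hβ) J))
    (α : Ordinal.{0}) (hα : α < ω₁) : p (finPow α) := by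
  suffices h : p (finPowPair α).2 from h
  induction α using Ordinal.limitRecOn with
  | zero =>
    rw [finPowPair, Ordinal.limitRecOn_zero]
    exact zero
  | add_one β ih =>
    specialize ih ((lt_add_one β).trans hα)
    rw [finPowPair] at ih ⊢
    rw [Ordinal.limitRecOn_add_one]
    by_cases hβ : β = 0
    · rw [if_pos hβ]
      exact one
    · rw [if_neg hβ]
      exact succ _ ih
  | limit β hβ ih =>
    rw [finPowPair, Ordinal.limitRecOn_limit _ _ _ _ hβ]
    exact limit β hβ hα _ fun γ => ih γ.1 γ.2 (lt_trans γ.2 hα)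

instance : IsProbabilityMeasure cantorMeasure := by
  unfold cantorMeasure
  infer_instance

theorem isMeasurablyFubini_principal_empty {Ω : Type*} [MeasurableSpace Ω] (μ : Measure Ω)
    [IsFiniteMeasure μ] (X : Type*) [Countable X] :
    IsMeasurablyFubini μ (Order.Ideal.principal (∅ : Set X)) :=
  .of_hasCountableCofinal ⟨{∅}, Set.countable_singleton _,
    fun _ hC => (Set.mem_singleton_iff.1 hC).le, fun _ hS => ⟨∅, rfl, hS⟩⟩

theorem isMeasurablyFubini_finPow {Ω : Type*} [MeasurableSpace Ω] (μ : Measure Ω)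
    [IsFiniteMeasure μ] {α : Ordinal.{0}} (hα : α < ω₁) : IsMeasurablyFubini μ (finPow α) := by
  refine finPow_induction (p := fun I => IsMeasurablyFubini μ I)
    (isMeasurablyFubini_principal_empty μ _)
    (.of_hasCountableCofinal (hasCountableCofinal_finIdeal _)) ?_ ?_ α hα
  · intro X I hI
    exact .fubiniProd (.of_hasCountableCofinal (hasCountableCofinal_finIdeal ℕ)) hI
  · intro β hβ hβω Y J hJ
    have := countable_Iio_of_lt_omega_one hβω
    exact .idealLim (.of_hasCountableCofinal (hasCountableCofinal_bnd β hβ)) hJ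

theorem univ_notMem_bnd (α : Ordinal.{0}) (hα : Order.IsSuccLimit α) :
    Set.univ ∉ bnd α hα := fun ⟨γ, hγ⟩ => lt_irrefl γ (hγ γ trivial)

theorem univ_notMem_idealLim {X : Type*} {Y : X → Type*} {I : Order.Ideal (Set X)}
    {J : ∀ i, Order.Ideal (Set (Y i))} (hI : Set.univ ∉ I) (hJ : ∀ i, Set.univ ∉ J i) :
    Set.univ ∉ idealLim I J :=
  fun h => hI (I.lower (fun i _ => hJ i) h)

theorem univ_notMem_fubiniProd {X Y : Type*} {I : Order.Ideal (Set X)} {J : Order.Ideal (Set Y)}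
    (hI : Set.univ ∉ I) (hJ : Set.univ ∉ J) : Set.univ ∉ fubiniProd I J :=
  fun h => hI (I.lower (fun _ _ => hJ) h)

theorem univ_notMem_finPow {α : Ordinal.{0}} (hα : α < ω₁) : Set.univ ∉ finPow α := by
  refine finPow_induction (p := fun I => Set.univ ∉ I) ?_ Set.infinite_univ ?_ ?_ α hα
  · exact fun h => h (Set.mem_univ PUnit.unit)
  · intro X I hI
    exact univ_notMem_fubiniProd (Set.infinite_univ (α := ℕ)) hI
  · intro β hβ _ Y J hJ
    exact univ_notMem_idealLim (univ_notMem_bnd β hβ) hJ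

/-! ### The Solecki ideal -/

theorem FubiniProperty.not_katetovLE_solecki {X : Type*} {I : Order.Ideal (Set X)}
    (hI : FubiniProperty I) (hproper : Set.univ ∉ I) : ¬ KatetovLE solecki I := by
  rintro ⟨f, hf⟩
  let _ : TopologicalSpace X := ⊥
  have : DiscreteTopology X := ⟨rfl⟩
  let A : Set (X × (ℕ → Bool)) := {p | p.2 ∈ (f p.1).1}
  have hA : IsOpen A := by
    have : A = ⋃ n, {n} ×ˢ ((f n).1 : Set (ℕ → Bool)) := by
      ext ⟨n, x⟩
      simp [A]
    rw [this]
    exact isOpen_iUnion fun n => (isOpen_discrete _).prod (f n).1.isClopen.isOpen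
  have hquarter (n : X) : ENNReal.ofReal (1 / 4) < cantorMeasure {x | (n, x) ∈ A} := by
    have hn : cantorMeasure {x | (n, x) ∈ A} = ENNReal.ofReal (1 / 2) := by
      rw [ENNReal.ofReal_div_of_pos two_pos, ENNReal.ofReal_one, ENNReal.ofReal_ofNat]
      exact (f n).2
    rw [hn]
    exact (ENNReal.ofReal_lt_ofReal_iff (by norm_num)).2 (by norm_num)
  have hle := hI A (MeasurableSpace.measurableSet_generateFrom hA) (1 / 4) (by norm_num)
    fun h => hproper (I.lower (fun n _ => hquarter n) h)
  have hempty : {x : ℕ → Bool | {n : X | (n, x) ∈ A} ∈ positive I} = ∅ := by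
    refine Set.eq_empty_of_forall_notMem fun x hx => hx (hf (soleckiSet x) ?_)
    exact ⟨{x}, Set.finite_singleton x, by simp⟩
  rw [hempty, measure_empty, nonpos_iff_eq_zero, ENNReal.ofReal_eq_zero] at hle
  norm_num at hle

end FubiniIdeals

theorem mainTheorem7 :
    (∀ α : Ordinal.{0}, α < ω₁ → FubiniIdeals.FubiniProperty (FubiniIdeals.finPow α)) ∧
    (∀ α : Ordinal.{0}, α < ω₁ →
      ¬ FubiniIdeals.KatetovLE FubiniIdeals.solecki (FubiniIdeals.finPow α)) := by
  have h (α : Ordinal.{0}) (hα : α < ω₁) :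
      FubiniIdeals.FubiniProperty (FubiniIdeals.finPow α) :=
    .of_isMeasurablyFubini (FubiniIdeals.isMeasurablyFubini_finPow _ hα)
  exact ⟨h, fun α hα => (h α hα).not_katetovLE_solecki (FubiniIdeals.univ_notMem_finPow hα)⟩
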